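/- Let $n,J,L\in\mathbb N$ and $m\in\mathbb N$, and let $P=(P_{jl})\in\mathbb C[z]^{J\times L}$, $z=(z_1,\dots,z_n)$, be a matrix of polynomials each of whose nonzero entries is homogeneous of degree $m$. Let $$M:=P^t\,\mathbb C[z]^J=\bigcap_{\sigma=1}^{\mu}M_\sigma\subset\mathbb C[z]^L$$ be a primary decomposition, let $\mathfrak p_\sigma=\sqrt{\operatorname{Ann}(\mathbb C[z]^L/M_\sigma)}$ be the prime ideal associated with the primary submodule $M_\sigma$, and let $V_{\mathfrak p_\sigma}\subset\mathbb C^n$ be its zero set. For every $\sigma$ let $\tilde{\mathcal B}_{\sigma i}$, $1\le i\le\rho_\sigma$, be Noetherian operators for $M_\sigma$, that is, operators $$\tilde{\mathcal B}_{\sigma i}(z,\partial_z)f=\sum_{|\alpha|\le A}\sum_{l=1}^{L}a^{l}_{\sigma i,\alpha}(z)\,\partial_z^\alpha f^l,\qquad a_{\sigma i,\alpha}=(a^1_{\sigma i,\alpha},\dots,a^L_{\sigma i,\alpha})\in\mathbb C[z]^L,$$ such that $f\in\mathbb C[z]^L$ belongs to $M_\sigma$ if and only if $\tilde{\mathcal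 B}_{\sigma i}(z,\partial_z)f$ vanishes on $V_{\mathfrak p_\sigma}$ for all $1\le i\le\rho_\sigma$. Let $\mathcal B_{\sigma i}(z,\partial_z)g=\sum_{|\alpha|\le A}a_{\sigma i,\alpha}(z)\,\partial_z^\alpha g\in\mathbb C^L$ be the associated vector-valued operators on scalar functions $g$. Let $\lambda\in\mathbb C$ and let $\Omega\subset\mathbb R^n$ be a nonempty open convex cone ($tx\in\Omega$ for $x\in\Omega$, $t>0$) that is pointed, i.e. $\overline\Omega\cap(-\overline\Omega)=\{0\}$. Put $\langle x,z\rangle=\sum_i x_iz_i$ and $$U_\Omega:=\{z\in\mathbb C^n:\ \langle x,\operatorname{Re}z\rangle<0\ \text{ for all }x\in\overline\Omega\setminus\{0\}\},$$ and let powers be taken in the principal branch. Define $$S_{\mathcal B,\lambda}(\Omega):=\bigl\{\Omega\ni x\mapsto\mathcal B_{\sigma i}(z,\partial_z)(-\langle x,z\rangle)^\lambda:\ 1\le\sigma\le\mu,\ 1\le i\le\rho_\sigma,\ z\in V_{\mathfrak p_\sigma}\cap U_\Omega\bigr\},$$ $$S(\Omega):=\{u\in C^\infty(\Omega)^L:\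 P(\partial_x)u=0\},\qquad H_\lambda(\Omega):=\{u\in C^\infty(\Omega):\ x\cdot\nabla u=\lambda u\}.$$ Then $$S_{\mathcal B,\lambda}(\Omega)\subset S(\Omega)\cap H_\lambda(\Omega)^L ,$$ that is, every function $x\mapsto\mathcal B_{\sigma i}(z,\partial_z)(-\langle x,z\rangle)^\lambda$ with $z\in V_{\mathfrak p_\sigma}\cap U_\Omega$ is a smooth $\lambda$-homogeneous solution of $P(\partial_x)u=0$ on $\Omega$. -/

import Mathlib

open scoped ContDiff Pointwise

noncomputable section

namespace HomogSol

/-- The `i`-th partial derivative of `f` on `𝕜ⁿ` (real partial derivatives for `𝕜 = ℝ`,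
holomorphic ones for `𝕜 = ℂ`). -/
def partialD (𝕜 : Type*) [NontriviallyNormedField 𝕜] {n : ℕ} {F : Type*} [NormedAddCommGroup F]
    [NormedSpace 𝕜 F] (i : Fin n) (f : (Fin n → 𝕜) → F) : (Fin n → 𝕜) → F :=
  fun x => fderiv 𝕜 f x (Pi.single i 1)

/-- `∂^α f = ∂₁^{α₁} ⋯ ∂ₙ^{αₙ} f` for a multi-index `α`. -/
def multiD (𝕜 : Type*) [NontriviallyNormedField 𝕜] {n : ℕ} {F : Type*} [NormedAddCommGroup F]
    [NormedSpace 𝕜 F] (α : Fin n →₀ ℕ) (f : (Fin n → 𝕜) → F) : (Fin n → 𝕜) → F :=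
  (List.finRange n).foldr (fun i g => (partialD 𝕜 i)^[α i] g) f

/-- The constant-coefficient operator `p(∂ₓ)`, acting on complex-valued functions on `ℝⁿ`. -/
def constCoeffOp {n : ℕ} (p : MvPolynomial (Fin n) ℂ) (u : (Fin n → ℝ) → ℂ) : (Fin n → ℝ) → ℂ :=
  fun x => ∑ α ∈ p.support, p.coeff α * multiD ℝ α u x

/-- The solution space `S(Ω)` of the system `P(∂ₓ) u = 0` on `Ω`. A function on `Ω` is represented
by any function on `ℝⁿ` extending it; for open `Ω` the membership depends on `u|_Ω` only. -/
def solutionSpace {n J L : ℕ} (P : Matrix (Fin J) (Fin L) (MvPolynomial (Fin n) ℂ))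
    (Ω : Set (Fin n → ℝ)) : Set ((Fin n → ℝ) → (Fin L → ℂ)) :=
  {u | ContDiffOn ℝ ∞ u Ω ∧
    ∀ j, ∀ x ∈ Ω, ∑ l, constCoeffOp (P j l) (fun y => u y l) x = 0}

/-- The Euler operator `E_λ = x · ∇ - λ`. -/
def eulerOp {n : ℕ} (lam : ℂ) (u : (Fin n → ℝ) → ℂ) : (Fin n → ℝ) → ℂ :=
  fun x => ∑ i, (x i : ℂ) * partialD ℝ i u x - lam * u x

/-- The space `H_λ(Ω)`: the kernel of `E_λ` on `C^∞(Ω)`. -/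
def homogSpace {n : ℕ} (lam : ℂ) (Ω : Set (Fin n → ℝ)) : Set ((Fin n → ℝ) → ℂ) :=
  {u | ContDiffOn ℝ ∞ u Ω ∧ ∀ x ∈ Ω, eulerOp lam u x = 0}

/-- The space `H_λ(Ω)^L`. -/
def homogSpaceVec {n : ℕ} (L : ℕ) (lam : ℂ) (Ω : Set (Fin n → ℝ)) :
    Set ((Fin n → ℝ) → (Fin L → ℂ)) :=
  {u | ∀ l, (fun x => u x l) ∈ homogSpace lam Ω}

/-- Nonempty open pointed convex cones. -/
structure IsOPC {n : ℕ} (Ω : Set (Fin n → ℝ)) : Prop where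
  nonempty : Ω.Nonempty
  isOpen : IsOpen Ω
  convex : Convex ℝ Ω
  cone : ∀ x ∈ Ω, ∀ t : ℝ, 0 < t → t • x ∈ Ω
  pointed : closure Ω ∩ -closure Ω = {0}

/-- The strict negative dual cone `X^∨`. -/
def strictNegDual {n : ℕ} (X : Set (Fin n → ℝ)) : Set (Fin n → ℝ) :=
  {η | ∀ x ∈ closure X \ {0}, ∑ i, x i * η i < 0}

/-- The tube `U_X = {z : Re z ∈ X^∨}`. -/
def tube {n : ℕ} (X : Set (Fin n → ℝ)) : Set (Fin n → ℂ) :=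
  {z | (fun i => (z i).re) ∈ strictNegDual X}

/-- The kernel `(-⟨x,z⟩)^λ` (principal branch), with `⟨x,z⟩ = ∑ᵢ xᵢ zᵢ`. -/
def kernel {n : ℕ} (lam : ℂ) (x : Fin n → ℝ) (z : Fin n → ℂ) : ℂ :=
  (-∑ i, (x i : ℂ) * z i) ^ lam

/-- The coefficients of `∑_α a_α(z) ∂_z^α` (a finite sum) with `a_α ∈ ℂ[z]^L`. -/
abbrev PolyDiffOp (n L : ℕ) : Type :=
  (Fin n →₀ ℕ) →₀ (Fin L → MvPolynomial (Fin n) ℂ)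

/-- The scalar-valued operator `f ↦ ∑_α ∑_l a_α^l(z) ∂_z^α f^l` on `ℂ^L`-valued functions. -/
def PolyDiffOp.scalarApply {n L : ℕ} (B : PolyDiffOp n L) (f : (Fin n → ℂ) → (Fin L → ℂ))
    (z : Fin n → ℂ) : ℂ :=
  ∑ α ∈ B.support, ∑ l, MvPolynomial.eval z (B α l) * multiD ℂ α (fun w => f w l) z

/-- The `ℂ^L`-valued operator `f ↦ ∑_α a_α(z) ∂_z^α f` on scalar functions. -/
def PolyDiffOp.vecApply {n L : ℕ} (B : PolyDiffOp n L) (f : (Fin n → ℂ) → ℂ)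
    (z : Fin n → ℂ) : Fin L → ℂ :=
  fun l => ∑ α ∈ B.support, MvPolynomial.eval z (B α l) * multiD ℂ α f z

/-- The submodule `P^t ℂ[z]^J` of `ℂ[z]^L`. -/
def transposeModule {n J L : ℕ} (P : Matrix (Fin J) (Fin L) (MvPolynomial (Fin n) ℂ)) :
    Submodule (MvPolynomial (Fin n) ℂ) (Fin L → MvPolynomial (Fin n) ℂ) :=
  LinearMap.range P.transpose.mulVecLin

/-- `M = ⋂_σ N σ` with every `N σ` primary. -/
structure IsPrimaryDecomposition {R E : Type*} [CommRing R] [AddCommGroup E] [Module R E] {μ : ℕ}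
    (M : Submodule R E) (N : Fin μ → Submodule R E) : Prop where
  primary : ∀ σ, (N σ).IsPrimary
  iInf_eq : M = ⨅ σ, N σ

/-- The prime ideal `√Ann(E/N)` associated with a primary submodule `N` of `E`. -/
def assocPrime {R E : Type*} [CommRing R] [AddCommGroup E] [Module R E] (N : Submodule R E) :
    Ideal R :=
  (N.colon Set.univ).radical

/-- The affine variety in `ℂⁿ` of the prime ideal associated with `N`. -/
def charVariety {n L : ℕ}
    (N : Submodule (MvPolynomial (Fin n) ℂ) (Fin L → MvPolynomial (Fin n) ℂ)) :
    Set (Fin n → ℂ) :=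
  MvPolynomial.zeroLocus ℂ (assocPrime N)

/-- `B₁, …, B_ρ` are Noetherian operators for the primary submodule `N ⊆ ℂ[z]^L` with
associated prime `𝔭`: a polynomial vector `f` lies in `N` if and only if all `B̃ᵢ(z,∂_z) f` vanish
on the variety of `𝔭`. -/
def IsNoetherianFamily {n L ρ : ℕ}
    (N : Submodule (MvPolynomial (Fin n) ℂ) (Fin L → MvPolynomial (Fin n) ℂ))
    (B : Fin ρ → PolyDiffOp n L) : Prop :=
  ∀ f : Fin L → MvPolynomial (Fin n) ℂ, f ∈ N ↔
    ∀ i, ∀ z ∈ charVariety N, (B i).scalarApply (fun w l => MvPolynomial.eval w (f l)) z = 0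

/-- The family `S_{B,λ}(Ω)` of the functions `x ↦ B_{σi}(z,∂_z) (-⟨x,z⟩)^λ` on `Ω`, with `z` in
`V_{𝔭_σ} ∩ U_Ω`. Again a function on `Ω` is represented by all its extensions to `ℝⁿ`. -/
def homogFamily {n L μ : ℕ} {ρ : Fin μ → ℕ}
    (N : Fin μ → Submodule (MvPolynomial (Fin n) ℂ) (Fin L → MvPolynomial (Fin n) ℂ))
    (B : (σ : Fin μ) → Fin (ρ σ) → PolyDiffOp n L) (lam : ℂ) (Ω : Set (Fin n → ℝ)) :
    Set ((Fin n → ℝ) → (Fin L → ℂ)) :=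
  {u | ∃ (σ : Fin μ) (i : Fin (ρ σ)), ∃ z ∈ charVariety (N σ) ∩ tube Ω,
    Set.EqOn u (fun x => (B σ i).vecApply (kernel lam x) z) Ω}

end HomogSol

end

/-!
Write `(-⟨x, z⟩)^λ = h(⟨x, z⟩)` with `h(s) = (-s)^λ`, which is holomorphic for `Re s < 0`. If `p` is
homogeneous of degree `m`, then `p(∂ₓ) h(⟨x, w⟩) = p(w) h⁽ᵐ⁾(⟨x, w⟩)`. Since `∂ₓ` and `∂_z` commute
on jointly analytic functions, the `j`-th component of `P(∂ₓ) B(z, ∂_z) h(⟨x, z⟩)` is the operator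
`B̃` applied to the vector `w ↦ h⁽ᵐ⁾(⟨x, w⟩) P_j(w)`, where `P_j` is the `j`-th row of `P`. Were
`h⁽ᵐ⁾` a polynomial, this vector would lie in `P^t ℂ[w]^J` and `B̃` would annihilate it at `z`;
and only finitely many derivatives of `h⁽ᵐ⁾` at `⟨x, z⟩` matter, so that `h⁽ᵐ⁾` may be replaced
by a polynomial. Homogeneity in `x` is inherited from the kernel, and Euler's equation follows by
differentiating along rays.
-/

noncomputable section

namespace HomogSol

open MvPolynomial Filter Topology

section DirectionalDerivatives

variable (𝕜 : Type*) [NontriviallyNormedField 𝕜] {E F : Type*} [NormedAddCommGroup E]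
  [NormedSpace 𝕜 E] [NormedAddCommGroup F] [NormedSpace 𝕜 F]

/-- The iterated directional derivative `∂_{v₁} ⋯ ∂_{vₖ} f` for `l = [v₁, …, vₖ]`. Mixed partial
derivatives in two groups of variables are compared by reordering the list. -/
def iterDirDeriv (l : List E) (f : E → F) : E → F :=
  l.foldr (fun v g x => fderiv 𝕜 g x v) f

variable {𝕜}

theorem iterDirDeriv_cons (v : E) (l : List E) (f : E → F) (x : E) :
    iterDirDeriv 𝕜 (v :: l) f x = fderiv 𝕜 (iterDirDeriv 𝕜 l f) x v :=
  rfl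

theorem iterDirDeriv_append (l l' : List E) (f : E → F) :
    iterDirDeriv 𝕜 (l ++ l') f = iterDirDeriv 𝕜 l (iterDirDeriv 𝕜 l' f) :=
  List.foldr_append

theorem iterDirDeriv_congr {f g : E → F} {x : E} (h : f =ᶠ[𝓝 x] g) (l : List E) :
    iterDirDeriv 𝕜 l f =ᶠ[𝓝 x] iterDirDeriv 𝕜 l g := by
  induction l with
  | nil => exact h
  | cons v l ih => exact ih.fderiv.fun_comp (· v)

theorem iterDirDeriv_const_smul {R : Type*} [DivisionRing R] [Module R F] [SMulCommClass 𝕜 R F]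
    [ContinuousConstSMul R F] (l : List E) (c : R) (f : E → F) :
    iterDirDeriv 𝕜 l (c • f) = c • iterDirDeriv 𝕜 l f := by
  induction l with
  | nil => rfl
  | cons v l ih =>
    funext x
    simp only [iterDirDeriv_cons, ih, fderiv_const_smul_field, Pi.smul_apply, smul_apply]

variable [CompleteSpace F]

theorem analyticAt_iterDirDeriv {f : E → F} {x : E} (hf : AnalyticAt 𝕜 f x) (l : List E) :
    AnalyticAt 𝕜 (iterDirDeriv 𝕜 l f) x := by
  induction l with
  | nil => exact hf
  | cons v l ih => exact ((ContinuousLinearMap.apply 𝕜 F v).analyticAt _).comp ih.fderiv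

theorem iterDirDeriv_add {f g : E → F} {x : E} (hf : AnalyticAt 𝕜 f x) (hg : AnalyticAt 𝕜 g x)
    (l : List E) :
    iterDirDeriv 𝕜 l (f + g) x = iterDirDeriv 𝕜 l f x + iterDirDeriv 𝕜 l g x := by
  induction l generalizing x with
  | nil => rfl
  | cons v l ih =>
    have h : iterDirDeriv 𝕜 l (f + g) =ᶠ[𝓝 x] iterDirDeriv 𝕜 l f + iterDirDeriv 𝕜 l g := by
      filter_upwards [hf.eventually_analyticAt, hg.eventually_analyticAt] with y using ih
    simp only [iterDirDeriv_cons]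
    rw [h.fderiv_eq, fderiv_add (analyticAt_iterDirDeriv hf l).differentiableAt
      (analyticAt_iterDirDeriv hg l).differentiableAt, add_apply]

theorem iterDirDeriv_sum {ι : Type*} (s : Finset ι) {f : ι → E → F} {x : E}
    (hf : ∀ i ∈ s, AnalyticAt 𝕜 (f i) x) (l : List E) :
    iterDirDeriv 𝕜 l (∑ i ∈ s, f i) x = ∑ i ∈ s, iterDirDeriv 𝕜 l (f i) x := by
  classical
  induction s using Finset.induction_on with
  | empty => simpa using congr($(iterDirDeriv_const_smul (𝕜 := 𝕜) l (0 : 𝕜) (0 : E → F)) x)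
  | insert i s hi ih =>
    have hs : ∀ j ∈ s, AnalyticAt 𝕜 (f j) x := fun j hj => hf j (Finset.mem_insert_of_mem hj)
    rw [Finset.sum_insert hi, Finset.sum_insert hi, iterDirDeriv_add
      (hf i (Finset.mem_insert_self i s)) (Finset.analyticAt_sum s hs), ih hs]

theorem iterDirDeriv_perm {f : E → F} {x : E} (hf : AnalyticAt 𝕜 f x) {l l' : List E}
    (h : l.Perm l') : iterDirDeriv 𝕜 l f x = iterDirDeriv 𝕜 l' f x := by
  induction h generalizing x with
  | nil => rfl
  | cons v _ ih =>
    exact congr($(EventuallyEq.fderiv_eq <| hf.eventually_analyticAt.mono fun _ => ih) v)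
  | swap v w l =>
    have hl := analyticAt_iterDirDeriv hf l
    have hd := hl.fderiv.differentiableAt
    have hsymm := (hl.contDiffAt (n := ⊤)).isSymmSndFDerivAt le_top v w
    have hswap (v w : E) : iterDirDeriv 𝕜 (w :: v :: l) f x =
        fderiv 𝕜 (fderiv 𝕜 (iterDirDeriv 𝕜 l f)) x w v := by
      change fderiv 𝕜 (fun y => fderiv 𝕜 (iterDirDeriv 𝕜 l f) y v) x w = _
      simp [fderiv_clm_apply hd (differentiableAt_const _)]
    rw [hswap, hswap, hsymm]
  | trans _ _ ih ih' => exact (ih hf).trans (ih' hf)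

theorem iterDirDeriv_cons' {f : E → F} {x : E} (hf : AnalyticAt 𝕜 f x) (v : E) (l : List E) :
    iterDirDeriv 𝕜 (v :: l) f x = iterDirDeriv 𝕜 l (fun y => fderiv 𝕜 f y v) x := by
  rw [iterDirDeriv_perm hf (List.perm_append_singleton v l).symm, iterDirDeriv_append]
  rfl

theorem iterDirDeriv_comm {f : E → F} {x : E} (hf : AnalyticAt 𝕜 f x) (l l' : List E) :
    iterDirDeriv 𝕜 l (iterDirDeriv 𝕜 l' f) x = iterDirDeriv 𝕜 l' (iterDirDeriv 𝕜 l f) x := by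
  rw [← iterDirDeriv_append, ← iterDirDeriv_append, iterDirDeriv_perm hf List.perm_append_comm]

theorem iterDirDeriv_comp {𝕜' E' : Type*} [NontriviallyNormedField 𝕜'] [NormedAlgebra 𝕜' 𝕜]
    [NormedAddCommGroup E'] [NormedSpace 𝕜' E'] [NormedSpace 𝕜' E] [IsScalarTower 𝕜' 𝕜 E]
    [NormedSpace 𝕜' F] [IsScalarTower 𝕜' 𝕜 F] {f : E → F} {ι : E' → E} {A : E' →L[𝕜'] E}
    (hι : ∀ y, HasFDerivAt ι A y) {y : E'} (hf : AnalyticAt 𝕜 f (ι y)) (l : List E') :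
    iterDirDeriv 𝕜' l (f ∘ ι) y = iterDirDeriv 𝕜 (l.map A) f (ι y) := by
  induction l generalizing y with
  | nil => rfl
  | cons v l ih =>
    have h : iterDirDeriv 𝕜' l (f ∘ ι) =ᶠ[𝓝 y] iterDirDeriv 𝕜 (l.map A) f ∘ ι :=
      ((hι y).continuousAt.eventually hf.eventually_analyticAt).mono fun _ => ih
    have hl := (analyticAt_iterDirDeriv hf (l.map A)).differentiableAt.hasFDerivAt
    rw [iterDirDeriv_cons, h.fderiv_eq, ((hl.restrictScalars 𝕜').comp y (hι y)).fderiv]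
    rfl

end DirectionalDerivatives

section RidgeFunctions

variable {𝕜 : Type*} [NontriviallyNormedField 𝕜]

theorem iterDirDeriv_eq_prod_mul_iteratedDeriv (l : List 𝕜) (g : 𝕜 → 𝕜) (t : 𝕜) :
    iterDirDeriv 𝕜 l g t = l.prod * iteratedDeriv l.length g t := by
  induction l generalizing t with
  | nil => simp [iterDirDeriv]
  | cons v l ih =>
    have h : iterDirDeriv 𝕜 l g = l.prod • iteratedDeriv l.length g := funext ih
    rw [iterDirDeriv_cons, h, fderiv_const_smul_field, List.prod_cons, List.length_cons,
      iteratedDeriv_succ, Pi.smul_apply, smul_apply, ← toSpanSingleton_deriv]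
    simp only [ContinuousLinearMap.toSpanSingleton_apply, smul_eq_mul]
    ring

theorem iteratedDeriv_polynomial_eval (Q : Polynomial 𝕜) (k : ℕ) (t : 𝕜) :
    iteratedDeriv k (fun s => Q.eval s) t = (Polynomial.derivative^[k] Q).eval t := by
  induction k generalizing t with
  | zero => simp
  | succ k ih => rw [iteratedDeriv_succ, funext ih, Polynomial.deriv, Function.iterate_succ_apply']

theorem exists_polynomial_iteratedDeriv_eq [CharZero 𝕜] (g : 𝕜 → 𝕜) (t : 𝕜) (d : ℕ) :
    ∃ Q : Polynomial 𝕜, ∀ k ≤ d,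
      iteratedDeriv k (fun s => Q.eval s) t = iteratedDeriv k g t := by
  let S : Polynomial 𝕜 :=
    ∑ k ∈ Finset.range (d + 1), Polynomial.monomial k (iteratedDeriv k g t / k.factorial)
  refine ⟨Polynomial.taylor (-t) S, fun k hk => ?_⟩
  have hcoeff : (Polynomial.hasseDeriv k (Polynomial.taylor (-t) S)).eval t =
      iteratedDeriv k g t / k.factorial := by
    rw [← Polynomial.taylor_coeff, Polynomial.taylor_taylor, add_neg_cancel,
      Polynomial.taylor_zero]
    simp [S, Polynomial.finsetSum_coeff, Polynomial.coeff_monomial, hk]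
  rw [iteratedDeriv_polynomial_eval, ← Polynomial.factorial_smul_hasseDeriv, LinearMap.smul_apply,
    Polynomial.eval_smul, hcoeff, nsmul_eq_mul]
  exact mul_div_cancel₀ _ (Nat.cast_ne_zero.2 k.factorial_ne_zero)

variable [CompleteSpace 𝕜] {E : Type*} [NormedAddCommGroup E] [NormedSpace 𝕜 E]

theorem iterDirDeriv_comp_mul_congr (ℓ : E →L[𝕜] 𝕜) {g₁ g₂ : 𝕜 → 𝕜} {p : E → 𝕜} {z : E}
    (hg₁ : AnalyticAt 𝕜 g₁ (ℓ z)) (hg₂ : AnalyticAt 𝕜 g₂ (ℓ z)) (hp : AnalyticAt 𝕜 p z)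
    (l : List E) (h : ∀ k ≤ l.length, iteratedDeriv k g₁ (ℓ z) = iteratedDeriv k g₂ (ℓ z)) :
    iterDirDeriv 𝕜 l (fun w => g₁ (ℓ w) * p w) z =
      iterDirDeriv 𝕜 l (fun w => g₂ (ℓ w) * p w) z := by
  have hcomp {g : 𝕜 → 𝕜} (hg : AnalyticAt 𝕜 g (ℓ z)) : AnalyticAt 𝕜 (fun w => g (ℓ w)) z :=
    hg.comp (ℓ.analyticAt z)
  induction l generalizing g₁ g₂ p with
  | nil => simpa [iterDirDeriv] using congr($(h 0 le_rfl) * p z)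
  | cons v l ih =>
    have hdp : AnalyticAt 𝕜 (fun w => fderiv 𝕜 p w v) z := analyticAt_iterDirDeriv hp [v]
    have hℓp : AnalyticAt 𝕜 (fun w => ℓ v * p w) z := analyticAt_const.mul hp
    have leibniz {g : 𝕜 → 𝕜} (hg : AnalyticAt 𝕜 g (ℓ z)) :
        iterDirDeriv 𝕜 (v :: l) (fun w => g (ℓ w) * p w) z =
          iterDirDeriv 𝕜 l (fun w => deriv g (ℓ w) * (ℓ v * p w)) z +
            iterDirDeriv 𝕜 l (fun w => g (ℓ w) * fderiv 𝕜 p w v) z := by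
      rw [iterDirDeriv_cons' ((hcomp hg).fun_mul hp),
        ← iterDirDeriv_add ((hcomp hg.deriv).fun_mul hℓp) ((hcomp hg).fun_mul hdp)]
      refine (iterDirDeriv_congr ?_ l).eq_of_nhds
      filter_upwards [ℓ.continuous.continuousAt.eventually hg.eventually_analyticAt,
        hp.eventually_analyticAt] with w hgw hpw
      have hd := (hgw.differentiableAt.hasDerivAt.comp_hasFDerivAt w ℓ.hasFDerivAt).mul
        hpw.differentiableAt.hasFDerivAt
      change fderiv 𝕜 ((g ∘ ℓ) * p) w v = _
      rw [hd.fderiv]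
      simp only [Function.comp_apply, add_apply, smul_apply, smul_eq_mul, Pi.add_apply]
      ring
    rw [leibniz hg₁, leibniz hg₂]
    refine congr($(ih hg₁.deriv hg₂.deriv hℓp fun k hk => ?_) +
      $(ih hg₁ hg₂ hdp fun k hk => h k (hk.trans (Nat.le_succ _))))
    simpa only [iteratedDeriv_succ'] using h (k + 1) (Nat.succ_le_succ hk)

end RidgeFunctions

section MultiIndices

variable (𝕜 : Type*) [NontriviallyNormedField 𝕜] {n : ℕ}

/-- The list of directions with `∂^α = ∂_{v₁} ⋯ ∂_{vₖ}`: each basis vector `eᵢ` occurs `αᵢ`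
times. -/
def multiIndexDirs (α : Fin n →₀ ℕ) : List (Fin n → 𝕜) :=
  (List.finRange n).flatMap fun i => List.replicate (α i) (Pi.single i 1)

theorem length_multiIndexDirs (α : Fin n →₀ ℕ) : (multiIndexDirs 𝕜 α).length = α.degree := by
  simp [multiIndexDirs, List.length_flatMap, Finsupp.degree_eq_sum, ← List.ofFn_eq_map,
    List.sum_ofFn]

theorem prod_map_multiIndexDirs {M : Type*} [CommMonoid M] (α : Fin n →₀ ℕ)
    (g : (Fin n → 𝕜) → M) :
    ((multiIndexDirs 𝕜 α).map g).prod = ∏ i, g (Pi.single i 1) ^ α i := by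
  simp [multiIndexDirs, List.flatMap_def, List.prod_flatten,
    Function.comp_def, ← List.ofFn_eq_map, List.prod_ofFn]

variable {𝕜} {F : Type*} [NormedAddCommGroup F] [NormedSpace 𝕜 F]

theorem multiD_eq_iterDirDeriv (α : Fin n →₀ ℕ) (f : (Fin n → 𝕜) → F) :
    multiD 𝕜 α f = iterDirDeriv 𝕜 (multiIndexDirs 𝕜 α) f := by
  have hrep (i : Fin n) (k : ℕ) (g : (Fin n → 𝕜) → F) :
      (partialD 𝕜 i)^[k] g = iterDirDeriv 𝕜 (List.replicate k (Pi.single i 1)) g := by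
    induction k with
    | zero => rfl
    | succ k ih => rw [Function.iterate_succ_apply', ih]; rfl
  unfold multiD multiIndexDirs
  induction List.finRange n with
  | nil => rfl
  | cons i l ih => rw [List.foldr_cons, ih, hrep, List.flatMap_cons, iterDirDeriv_append]

theorem multiD_congr {f g : (Fin n → 𝕜) → F} {x : Fin n → 𝕜} (h : f =ᶠ[𝓝 x] g)
    (α : Fin n →₀ ℕ) : multiD 𝕜 α f =ᶠ[𝓝 x] multiD 𝕜 α g := by
  simpa only [multiD_eq_iterDirDeriv] using iterDirDeriv_congr h _

theorem multiD_const_smul {R : Type*} [DivisionRing R] [Module R F] [SMulCommClass 𝕜 R F]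
    [ContinuousConstSMul R F] (α : Fin n →₀ ℕ) (c : R) (f : (Fin n → 𝕜) → F) :
    multiD 𝕜 α (c • f) = c • multiD 𝕜 α f := by
  simpa only [multiD_eq_iterDirDeriv] using iterDirDeriv_const_smul _ c f

theorem multiD_sum_smul [CompleteSpace F] {R ι : Type*} [NormedDivisionRing R] [Module R F]
    [SMulCommClass 𝕜 R F] [IsBoundedSMul R F] (s : Finset ι) (c : ι → R)
    {f : ι → (Fin n → 𝕜) → F} {x : Fin n → 𝕜} (hf : ∀ i ∈ s, AnalyticAt 𝕜 (f i) x)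
    (α : Fin n →₀ ℕ) :
    multiD 𝕜 α (∑ i ∈ s, c i • f i) x = ∑ i ∈ s, c i • multiD 𝕜 α (f i) x := by
  simp only [multiD_eq_iterDirDeriv]
  rw [iterDirDeriv_sum s fun i hi => (hf i hi).const_smul]
  simp only [iterDirDeriv_const_smul, Pi.smul_apply]

end MultiIndices

section LinearForms

variable (𝕜 : Type*) [NontriviallyNormedField 𝕜] [NormedAlgebra 𝕜 ℂ] {n : ℕ}

/-- The pairing `y ↦ ⟨y, c⟩ = ∑ᵢ yᵢ cᵢ` with a fixed `c ∈ ℂⁿ`, as a `𝕜`-linear form. Both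
`𝕜 = ℝ` (for `x ↦ ⟨x, z⟩`) and `𝕜 = ℂ` (for `z ↦ ⟨x, z⟩`) are used. -/
def linearForm (c : Fin n → ℂ) : (Fin n → 𝕜) →L[𝕜] ℂ :=
  ∑ i, (ContinuousLinearMap.proj i).smulRight (c i)

variable {𝕜}

theorem linearForm_apply (c : Fin n → ℂ) (y : Fin n → 𝕜) :
    linearForm 𝕜 c y = ∑ i, y i • c i := by
  simp [linearForm]

theorem linearForm_single (c : Fin n → ℂ) (i : Fin n) :
    linearForm 𝕜 c (Pi.single i 1) = c i := by
  simp [linearForm_apply, Pi.single_apply, ite_smul]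

theorem linearForm_eq_dotProduct (c w : Fin n → ℂ) : linearForm ℂ c w = c ⬝ᵥ w := by
  simp [linearForm_apply, dotProduct, mul_comm]

theorem multiD_comp_linearForm (α : Fin n →₀ ℕ) {g : ℂ → ℂ} (c : Fin n → ℂ) {y : Fin n → 𝕜}
    (hg : AnalyticAt ℂ g (linearForm 𝕜 c y)) :
    multiD 𝕜 α (fun y => g (linearForm 𝕜 c y)) y =
      (∏ i, c i ^ α i) * iteratedDeriv α.degree g (linearForm 𝕜 c y) := by
  have h := iterDirDeriv_comp (fun y => (linearForm 𝕜 c).hasFDerivAt) hg (multiIndexDirs 𝕜 α)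
  rw [multiD_eq_iterDirDeriv]
  refine h.trans ?_
  rw [iterDirDeriv_eq_prod_mul_iteratedDeriv, prod_map_multiIndexDirs, List.length_map,
    length_multiIndexDirs]
  simp only [linearForm_single]

theorem constCoeffOp_comp_linearForm {m : ℕ} {p : MvPolynomial (Fin n) ℂ} (hp : p.IsHomogeneous m)
    {g : ℂ → ℂ} (c : Fin n → ℂ) {x : Fin n → ℝ} (hg : AnalyticAt ℂ g (linearForm ℝ c x)) :
    constCoeffOp p (fun y => g (linearForm ℝ c y)) x =
      iteratedDeriv m g (linearForm ℝ c x) * eval c p := by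
  rw [eval_eq', Finset.mul_sum]
  refine Finset.sum_congr rfl fun α hα => ?_
  have hdeg : α.degree = m := by_contra fun h => mem_support_iff.1 hα (hp.coeff_eq_zero h)
  rw [multiD_comp_linearForm α c hg, hdeg]
  ring

end LinearForms

section Slices

variable {k n : ℕ}

/-- The inclusion `ℝⁿ ⊆ ℂⁿ`. -/
def complexify (n : ℕ) : (Fin n → ℝ) →L[ℝ] (Fin n → ℂ) :=
  ContinuousLinearMap.piMap fun _ => Complex.ofRealCLM

theorem linearForm_real_eq_dotProduct (x : Fin n → ℝ) (c : Fin n → ℂ) :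
    linearForm ℝ c x = complexify n x ⬝ᵥ c := by
  simp [linearForm_apply, dotProduct, complexify]

variable {f : (Fin k → ℂ) × (Fin n → ℂ) → ℂ} {x : Fin k → ℝ} {z : Fin n → ℂ}

theorem hasFDerivAt_slice_left (z : Fin n → ℂ) (y : Fin k → ℝ) :
    HasFDerivAt (fun y => (complexify k y, z))
      ((ContinuousLinearMap.inl ℝ (Fin k → ℂ) (Fin n → ℂ)).comp (complexify k)) y :=
  (hasFDerivAt_prodMk_left _ z).comp y (complexify k).hasFDerivAt

theorem multiD_slice_left (β : Fin k →₀ ℕ) (hf : AnalyticAt ℂ f (complexify k x, z)) :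
    multiD ℝ β (fun y => f (complexify k y, z)) x =
      iterDirDeriv ℂ ((multiIndexDirs ℝ β).map fun v => (complexify k v, 0)) f
        (complexify k x, z) := by
  rw [multiD_eq_iterDirDeriv]
  exact iterDirDeriv_comp (hasFDerivAt_slice_left z) hf _

theorem multiD_slice_right (α : Fin n →₀ ℕ) {ξ : Fin k → ℂ} (hf : AnalyticAt ℂ f (ξ, z)) :
    multiD ℂ α (fun w => f (ξ, w)) z =
      iterDirDeriv ℂ ((multiIndexDirs ℂ α).map fun v => (0, v)) f (ξ, z) := by
  rw [multiD_eq_iterDirDeriv]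
  exact iterDirDeriv_comp (fun w => hasFDerivAt_prodMk_right (𝕜 := ℂ) ξ w) hf _

theorem multiD_slice_left_eventuallyEq (β : Fin k →₀ ℕ)
    (hf : AnalyticAt ℂ f (complexify k x, z)) :
    (fun w => multiD ℝ β (fun y => f (complexify k y, w)) x) =ᶠ[𝓝 z] fun w =>
      iterDirDeriv ℂ ((multiIndexDirs ℝ β).map fun v => (complexify k v, 0)) f
        (complexify k x, w) :=
  ((Continuous.prodMk_right (complexify k x)).continuousAt.eventually
    hf.eventually_analyticAt).mono fun _ => multiD_slice_left β

theorem multiD_slice_right_eventuallyEq (α : Fin n →₀ ℕ)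
    (hf : AnalyticAt ℂ f (complexify k x, z)) :
    (fun y => multiD ℂ α (fun w => f (complexify k y, w)) z) =ᶠ[𝓝 x] fun y =>
      iterDirDeriv ℂ ((multiIndexDirs ℂ α).map fun v => (0, v)) f (complexify k y, z) :=
  ((hasFDerivAt_slice_left z x).continuousAt.eventually
    hf.eventually_analyticAt).mono fun _ => multiD_slice_right α

theorem analyticAt_multiD_slice_left (β : Fin k →₀ ℕ)
    (hf : AnalyticAt ℂ f (complexify k x, z)) :
    AnalyticAt ℂ (fun w => multiD ℝ β (fun y => f (complexify k y, w)) x) z :=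
  ((analyticAt_iterDirDeriv hf _).comp (analyticAt_const.prod analyticAt_id)).congr
    (multiD_slice_left_eventuallyEq β hf).symm

theorem analyticAt_multiD_slice_right (α : Fin n →₀ ℕ)
    (hf : AnalyticAt ℂ f (complexify k x, z)) :
    AnalyticAt ℝ (fun y => multiD ℂ α (fun w => f (complexify k y, w)) z) x :=
  have hslice : AnalyticAt ℝ (fun y => (complexify k y, z)) x :=
    ((complexify k).analyticAt x).prod analyticAt_const
  AnalyticAt.congr (AnalyticAt.comp (f := fun y => (complexify k y, z))
    (analyticAt_iterDirDeriv hf _).restrictScalars hslice)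
    (multiD_slice_right_eventuallyEq α hf).symm

theorem multiD_slice_comm (β : Fin k →₀ ℕ) (α : Fin n →₀ ℕ)
    (hf : AnalyticAt ℂ f (complexify k x, z)) :
    multiD ℝ β (fun y => multiD ℂ α (fun w => f (complexify k y, w)) z) x =
      multiD ℂ α (fun w => multiD ℝ β (fun y => f (complexify k y, w)) x) z := by
  rw [(multiD_congr (multiD_slice_right_eventuallyEq α hf) β).eq_of_nhds,
    (multiD_congr (multiD_slice_left_eventuallyEq β hf) α).eq_of_nhds,
    multiD_slice_left β (analyticAt_iterDirDeriv hf _),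
    multiD_slice_right α (analyticAt_iterDirDeriv hf _), iterDirDeriv_comm hf]

variable {L : ℕ} (B : PolyDiffOp n L) (l : Fin L)

theorem PolyDiffOp.vecApply_congr {g₁ g₂ : (Fin n → ℂ) → ℂ} (h : g₁ =ᶠ[𝓝 z] g₂) :
    B.vecApply g₁ z = B.vecApply g₂ z := by
  funext l
  exact Finset.sum_congr rfl fun α _ => by rw [(multiD_congr h α).eq_of_nhds]

theorem PolyDiffOp.vecApply_const_smul (c : ℂ) (g : (Fin n → ℂ) → ℂ) :
    B.vecApply (c • g) z = c • B.vecApply g z := by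
  funext l
  simp [PolyDiffOp.vecApply, multiD_const_smul, Finset.mul_sum, mul_left_comm]

theorem PolyDiffOp.vecApply_sum_smul {ι : Type*} (s : Finset ι) (c : ι → ℂ)
    {g : ι → (Fin n → ℂ) → ℂ}
    (hg : ∀ i ∈ s, AnalyticAt ℂ (g i) z) :
    B.vecApply (∑ i ∈ s, c i • g i) z = ∑ i ∈ s, c i • B.vecApply (g i) z := by
  funext l
  simp only [PolyDiffOp.vecApply, multiD_sum_smul s c hg, Finset.sum_apply, Pi.smul_apply,
    smul_eq_mul, Finset.mul_sum]
  rw [Finset.sum_comm]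
  simp only [mul_left_comm]

theorem PolyDiffOp.scalarApply_eq_sum_vecApply (g : (Fin n → ℂ) → (Fin L → ℂ)) :
    B.scalarApply g z = ∑ l, B.vecApply (fun w => g w l) z l :=
  Finset.sum_comm

theorem analyticAt_vecApply_slice (hf : AnalyticAt ℂ f (complexify k x, z)) :
    AnalyticAt ℝ (fun y => B.vecApply (fun w => f (complexify k y, w)) z l) x :=
  Finset.analyticAt_fun_sum _ fun α _ =>
    analyticAt_const.mul (analyticAt_multiD_slice_right α hf)

theorem multiD_vecApply_slice (β : Fin k →₀ ℕ) (hf : AnalyticAt ℂ f (complexify k x, z)) :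
    multiD ℝ β (fun y => B.vecApply (fun w => f (complexify k y, w)) z l) x =
      B.vecApply (fun w => multiD ℝ β (fun y => f (complexify k y, w)) x) z l := by
  have h := multiD_sum_smul B.support (fun α => eval z (B α l))
    (fun α _ => analyticAt_multiD_slice_right α hf) β
  simp only [multiD_slice_comm β _ hf, smul_eq_mul] at h
  rw [PolyDiffOp.vecApply, ← h]
  congr 1
  funext y
  simp [PolyDiffOp.vecApply]

theorem constCoeffOp_vecApply_slice (p : MvPolynomial (Fin k) ℂ)
    (hf : AnalyticAt ℂ f (complexify k x, z)) :
    constCoeffOp p (fun y => B.vecApply (fun w => f (complexify k y, w)) z l) x =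
      B.vecApply (fun w => constCoeffOp p (fun y => f (complexify k y, w)) x) z l := by
  have h := B.vecApply_sum_smul p.support p.coeff fun β _ => analyticAt_multiD_slice_left β hf
  simp only [constCoeffOp, multiD_vecApply_slice B l _ hf]
  refine Eq.trans ?_ (congr($h l).symm.trans ?_)
  · simp
  · congr 2
    funext w
    simp

end Slices

section KernelSolutions

variable {n L m : ℕ}

theorem analyticAt_comp_dotProduct {h : ℂ → ℂ} {ξ z : Fin n → ℂ} (hh : AnalyticAt ℂ h (ξ ⬝ᵥ z)) :
    AnalyticAt ℂ (fun q : (Fin n → ℂ) × (Fin n → ℂ) => h (q.1 ⬝ᵥ q.2)) (ξ, z) := by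
  have hdot : AnalyticAt ℂ (fun q : (Fin n → ℂ) × (Fin n → ℂ) => q.1 ⬝ᵥ q.2) (ξ, z) :=
    Finset.analyticAt_fun_sum _ fun i _ => (analyticAt_pi_iff.1 analyticAt_fst i).mul
      (analyticAt_pi_iff.1 analyticAt_snd i)
  exact hh.comp_of_eq hdot rfl

theorem PolyDiffOp.sum_constCoeffOp_vecApply (B : PolyDiffOp n L)
    {p : Fin L → MvPolynomial (Fin n) ℂ} (hp : ∀ l, (p l).IsHomogeneous m) {h : ℂ → ℂ}
    {x : Fin n → ℝ} {z : Fin n → ℂ} (hh : AnalyticAt ℂ h (complexify n x ⬝ᵥ z)) :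
    ∑ l, constCoeffOp (p l) (fun y => B.vecApply (fun w => h (complexify n y ⬝ᵥ w)) z l) x =
      B.scalarApply (fun w l => iteratedDeriv m h (complexify n x ⬝ᵥ w) * eval w (p l)) z := by
  rw [B.scalarApply_eq_sum_vecApply]
  refine Finset.sum_congr rfl fun l _ => ?_
  rw [constCoeffOp_vecApply_slice B l (p l) (analyticAt_comp_dotProduct hh)]
  refine congrFun (B.vecApply_congr ?_) l
  have hcont : ContinuousAt (fun w => complexify n x ⬝ᵥ w) z := by fun_prop
  filter_upwards [hcont.eventually hh.eventually_analyticAt] with w hw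
  simp only [← linearForm_real_eq_dotProduct] at hw ⊢
  exact constCoeffOp_comp_linearForm (hp l) w hw

theorem eval_aeval_sum_C_mul_X (Q : Polynomial ℂ) (ξ w : Fin n → ℂ) :
    eval w (Q.aeval (∑ i, C (ξ i) * X i : MvPolynomial (Fin n) ℂ)) = Q.eval (ξ ⬝ᵥ w) := by
  rw [← coe_aeval_eq_eval, RingHom.coe_coe, ← Polynomial.aeval_algHom_apply]
  simp [dotProduct, Polynomial.aeval_def, Polynomial.eval₂_eq_eval_map]

/-- Only a finite jet of `g` at `⟨ξ, z⟩` enters, and it is the jet of a polynomial in one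
variable. -/
theorem PolyDiffOp.scalarApply_comp_mul_eq_zero (B : PolyDiffOp n L)
    {p : Fin L → MvPolynomial (Fin n) ℂ} {ξ z : Fin n → ℂ}
    (hB : ∀ q : MvPolynomial (Fin n) ℂ, B.scalarApply (fun w l => eval w ((q • p) l)) z = 0)
    {g : ℂ → ℂ} (hg : AnalyticAt ℂ g (ξ ⬝ᵥ z)) :
    B.scalarApply (fun w l => g (ξ ⬝ᵥ w) * eval w (p l)) z = 0 := by
  obtain ⟨Q, hQ⟩ := exists_polynomial_iteratedDeriv_eq g (ξ ⬝ᵥ z) (B.support.sup Finsupp.degree)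
  have hQan : AnalyticAt ℂ (fun s => Q.eval s) (ξ ⬝ᵥ z) :=
    AnalyticOnNhd.eval_polynomial Q _ (Set.mem_univ _)
  rw [← hB (Q.aeval (∑ i, C (ξ i) * X i))]
  refine Finset.sum_congr rfl fun α hα => Finset.sum_congr rfl fun l _ => ?_
  have hp : AnalyticAt ℂ (fun w => eval w (p l)) z :=
    AnalyticOnNhd.eval_mvPolynomial (p l) z (Set.mem_univ z)
  have hdeg : (multiIndexDirs ℂ α).length ≤ B.support.sup Finsupp.degree :=
    (length_multiIndexDirs ℂ α).trans_le (Finset.le_sup hα)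
  simp only [Pi.smul_apply, smul_eq_mul, map_mul, eval_aeval_sum_C_mul_X, multiD_eq_iterDirDeriv]
  simp only [← linearForm_eq_dotProduct] at hg hQ hQan ⊢
  rw [iterDirDeriv_comp_mul_congr _ hg hQan hp _ fun k hk => (hQ k (hk.trans hdeg)).symm]

end KernelSolutions

section Homogeneity

variable {n L : ℕ} {lam : ℂ}

theorem ofReal_mul_cpow {t : ℝ} (ht : 0 < t) (w lam : ℂ) :
    ((t : ℂ) * w) ^ lam = (t : ℂ) ^ lam * w ^ lam := by
  have ht' : (t : ℂ) ≠ 0 := Complex.ofReal_ne_zero.2 ht.ne'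
  rcases eq_or_ne w 0 with rfl | hw
  · rcases eq_or_ne lam 0 with rfl | hlam <;> simp [*]
  · rw [Complex.cpow_def_of_ne_zero (mul_ne_zero ht' hw), Complex.cpow_def_of_ne_zero ht',
      Complex.cpow_def_of_ne_zero hw, Complex.log_ofReal_mul ht hw, Complex.ofReal_log ht.le,
      add_mul, Complex.exp_add]

theorem kernel_smul {t : ℝ} (ht : 0 < t) (lam : ℂ) (x : Fin n → ℝ) :
    kernel lam (t • x) = (t : ℂ) ^ lam • kernel lam x := by
  funext z
  rw [Pi.smul_apply, smul_eq_mul, kernel, kernel, ← ofReal_mul_cpow ht, mul_neg, Finset.mul_sum]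
  simp [mul_assoc]

theorem eulerOp_eq_fderiv (lam : ℂ) (u : (Fin n → ℝ) → ℂ) (x : Fin n → ℝ) :
    eulerOp lam u x = fderiv ℝ u x x - lam * u x := by
  have h := congr(fderiv ℝ u x $(pi_eq_sum_univ' x))
  simp only [map_sum, map_smul, Complex.real_smul] at h
  rw [h]
  rfl

theorem eulerOp_eq_zero_of_homogeneous {u : (Fin n → ℝ) → ℂ} {x : Fin n → ℝ}
    (hu : DifferentiableAt ℝ u x) (hom : ∀ t : ℝ, 0 < t → u (t • x) = (t : ℂ) ^ lam * u x) :
    eulerOp lam u x = 0 := by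
  have hray : HasDerivAt (fun t : ℝ => u (t • x)) (fderiv ℝ u x x) 1 := by
    have hline : HasDerivAt (fun t : ℝ => t • x) x 1 := by
      simpa using (hasDerivAt_id (1 : ℝ)).smul_const x
    exact HasFDerivAt.comp_hasDerivAt_of_eq (1 : ℝ) hu.hasFDerivAt hline (one_smul ℝ x).symm
  have hpow : HasDerivAt (fun t : ℝ => (t : ℂ) ^ lam * u x) (lam * u x) 1 := by
    have h := (hasDerivAt_id (1:ℂ)).cpow_const (c := lam) (by simp)
    simpa using h.comp_ofReal.mul_const (u x)
  have heq : (fun t : ℝ => u (t • x)) =ᶠ[𝓝 1] fun t => (t : ℂ) ^ lam * u x :=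
    (lt_mem_nhds one_pos).mono hom
  rw [eulerOp_eq_fderiv, hray.unique (hpow.congr_of_eventuallyEq heq), sub_self]

theorem analyticAt_neg_cpow {s : ℂ} (hs : s.re < 0) (lam : ℂ) :
    AnalyticAt ℂ (fun s => (-s) ^ lam) s :=
  analyticAt_id.neg.cpow analyticAt_const (Or.inl (by simpa using hs))

theorem analyticAt_vecApply_kernel (B : PolyDiffOp n L) {x : Fin n → ℝ} {z : Fin n → ℂ}
    (hxz : (complexify n x ⬝ᵥ z).re < 0) (l : Fin L) :
    AnalyticAt ℝ (fun y => B.vecApply (kernel lam y) z l) x :=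
  analyticAt_vecApply_slice B l (analyticAt_comp_dotProduct (analyticAt_neg_cpow hxz lam))

theorem eulerOp_vecApply_kernel (B : PolyDiffOp n L) {x : Fin n → ℝ} {z : Fin n → ℂ}
    (hxz : (complexify n x ⬝ᵥ z).re < 0) (l : Fin L) :
    eulerOp lam (fun y => B.vecApply (kernel lam y) z l) x = 0 := by
  refine eulerOp_eq_zero_of_homogeneous (analyticAt_vecApply_kernel B hxz l).differentiableAt
    fun t ht => ?_
  rw [kernel_smul ht, B.vecApply_const_smul, Pi.smul_apply, smul_eq_mul]

theorem sum_constCoeffOp_vecApply_kernel {m J : ℕ}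
    {P : Matrix (Fin J) (Fin L) (MvPolynomial (Fin n) ℂ)} (hP : ∀ j l, (P j l).IsHomogeneous m)
    (B : PolyDiffOp n L) {x : Fin n → ℝ} {z : Fin n → ℂ}
    (hB : ∀ f ∈ transposeModule P, B.scalarApply (fun w l => eval w (f l)) z = 0)
    (hxz : (complexify n x ⬝ᵥ z).re < 0) (j : Fin J) :
    ∑ l, constCoeffOp (P j l) (fun y => B.vecApply (kernel lam y) z l) x = 0 := by
  have hrow : P j ∈ transposeModule P := ⟨Pi.single j 1, by ext1 l; simp⟩
  have hh : AnalyticAt ℂ (iteratedDeriv m fun s => (-s) ^ lam) (complexify n x ⬝ᵥ z) := by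
    simpa only [iteratedDeriv_eq_iterate] using (analyticAt_neg_cpow hxz lam).iterated_deriv m
  refine (B.sum_constCoeffOp_vecApply (hP j) (analyticAt_neg_cpow hxz lam)).trans ?_
  exact B.scalarApply_comp_mul_eq_zero (fun q => hB _ ((transposeModule P).smul_mem q hrow))
    hh

end Homogeneity

section Families

variable {n J L m : ℕ} {Ω : Set (Fin n → ℝ)}

theorem constCoeffOp_congr {u v : (Fin n → ℝ) → ℂ} {x : Fin n → ℝ} (h : u =ᶠ[𝓝 x] v)
    (p : MvPolynomial (Fin n) ℂ) : constCoeffOp p u x = constCoeffOp p v x :=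
  Finset.sum_congr rfl fun α _ => by rw [(multiD_congr h α).eq_of_nhds]

theorem eulerOp_congr {u v : (Fin n → ℝ) → ℂ} {x : Fin n → ℝ} (h : u =ᶠ[𝓝 x] v) (lam : ℂ) :
    eulerOp lam u x = eulerOp lam v x := by
  rw [eulerOp_eq_fderiv, eulerOp_eq_fderiv, h.fderiv_eq, h.eq_of_nhds]

theorem solutionSpace_congr {P : Matrix (Fin J) (Fin L) (MvPolynomial (Fin n) ℂ)}
    {u v : (Fin n → ℝ) → Fin L → ℂ} (hΩ : IsOpen Ω) (h : Set.EqOn u v Ω) :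
    u ∈ solutionSpace P Ω ↔ v ∈ solutionSpace P Ω := by
  refine and_congr (contDiffOn_congr h) (forall₃_congr fun j x hx => ?_)
  have hnear := h.eventuallyEq_of_mem (hΩ.mem_nhds hx)
  have hsum := Finset.sum_congr rfl fun l (_ : l ∈ Finset.univ) =>
    constCoeffOp_congr (hnear.fun_comp (· l)) (P j l)
  exact Eq.congr_left hsum

theorem homogSpaceVec_congr {lam : ℂ} {u v : (Fin n → ℝ) → Fin L → ℂ} (hΩ : IsOpen Ω)
    (h : Set.EqOn u v Ω) : u ∈ homogSpaceVec L lam Ω ↔ v ∈ homogSpaceVec L lam Ω := by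
  refine forall_congr' fun l => and_congr (contDiffOn_congr fun x hx => congrFun (h hx) l)
    (forall₂_congr fun x hx => ?_)
  have hnear := h.eventuallyEq_of_mem (hΩ.mem_nhds hx)
  exact Eq.congr_left (eulerOp_congr (hnear.fun_comp (· l)) lam)

theorem vecApply_kernel_mem_solutionSpace
    {P : Matrix (Fin J) (Fin L) (MvPolynomial (Fin n) ℂ)} (hP : ∀ j l, (P j l).IsHomogeneous m)
    {B : PolyDiffOp n L} {z : Fin n → ℂ}
    (hB : ∀ f ∈ transposeModule P, B.scalarApply (fun w l => eval w (f l)) z = 0) (lam : ℂ)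
    (hz : ∀ x ∈ Ω, (complexify n x ⬝ᵥ z).re < 0) :
    (fun x => B.vecApply (kernel lam x) z) ∈ solutionSpace P Ω :=
  ⟨contDiffOn_pi.2 fun l x hx =>
      (analyticAt_vecApply_kernel B (hz x hx) l).contDiffAt.contDiffWithinAt,
    fun j x hx => sum_constCoeffOp_vecApply_kernel hP B hB (hz x hx) j⟩

theorem vecApply_kernel_mem_homogSpaceVec (B : PolyDiffOp n L) (lam : ℂ) {z : Fin n → ℂ}
    (hz : ∀ x ∈ Ω, (complexify n x ⬝ᵥ z).re < 0) :
    (fun x => B.vecApply (kernel lam x) z) ∈ homogSpaceVec L lam Ω := fun l =>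
  ⟨fun x hx => (analyticAt_vecApply_kernel B (hz x hx) l).contDiffAt.contDiffWithinAt,
    fun x hx => eulerOp_vecApply_kernel B (hz x hx) l⟩

theorem re_dotProduct_neg_of_mem_tube (h0 : 0 ∉ Ω) {x : Fin n → ℝ} (hx : x ∈ Ω) {z : Fin n → ℂ}
    (hz : z ∈ tube Ω) : (complexify n x ⬝ᵥ z).re < 0 := by
  simpa [dotProduct, complexify, Complex.re_sum] using
    hz x ⟨subset_closure hx, ne_of_mem_of_not_mem hx h0⟩

theorem IsOPC.zero_notMem (hΩ : IsOPC Ω) (hn : 1 ≤ n) : 0 ∉ Ω := by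
  intro h0
  have : Nonempty (Fin n) := ⟨⟨0, hn⟩⟩
  have hmem : ∀ᶠ y in 𝓝[≠] (0 : Fin n → ℝ), y ∈ Ω ∧ -y ∈ Ω :=
    ((hΩ.isOpen.eventually_mem h0).and <|
      continuous_neg.continuousAt.eventually (hΩ.isOpen.eventually_mem (by simpa))).filter_mono
        nhdsWithin_le_nhds
  obtain ⟨y, ⟨hy, hy'⟩, hy0⟩ := (hmem.and self_mem_nhdsWithin).exists
  have : y ∈ closure Ω ∩ -closure Ω := ⟨subset_closure hy, subset_closure hy'⟩
  rw [hΩ.pointed] at this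
  exact hy0 this

end Families

end HomogSol

end

open HomogSol in
theorem proposition3p4_general {n J L m μ : ℕ}
    (P : Matrix (Fin J) (Fin L) (MvPolynomial (Fin n) ℂ))
    (hP : ∀ j l, (P j l).IsHomogeneous m)
    (N : Fin μ → Submodule (MvPolynomial (Fin n) ℂ) (Fin L → MvPolynomial (Fin n) ℂ))
    (hN : ∀ σ, transposeModule P ≤ N σ)
    {ρ : Fin μ → ℕ} (B : (σ : Fin μ) → Fin (ρ σ) → PolyDiffOp n L)
    (hB : ∀ σ, ∀ f ∈ N σ, ∀ i, ∀ z ∈ charVariety (N σ),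
      (B σ i).scalarApply (fun w l => MvPolynomial.eval w (f l)) z = 0)
    (lam : ℂ) {Ω : Set (Fin n → ℝ)} (hΩ : IsOpen Ω) (h0 : 0 ∉ Ω) :
    homogFamily N B lam Ω ⊆ solutionSpace P Ω ∩ homogSpaceVec L lam Ω := by
  rintro u ⟨σ, i, z, ⟨hzN, hzΩ⟩, hu⟩
  have hneg : ∀ x ∈ Ω, (complexify n x ⬝ᵥ z).re < 0 := fun x hx =>
    re_dotProduct_neg_of_mem_tube h0 hx hzΩ
  have hvanish : ∀ f ∈ transposeModule P,
      (B σ i).scalarApply (fun w l => MvPolynomial.eval w (f l)) z = 0 := fun f hf =>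
    hB σ f (hN σ hf) i z hzN
  exact ⟨(solutionSpace_congr hΩ hu).2 (vecApply_kernel_mem_solutionSpace hP hvanish lam hneg),
    (homogSpaceVec_congr hΩ hu).2 (vecApply_kernel_mem_homogSpaceVec (B σ i) lam hneg)⟩

theorem proposition3p4 {n J L m μ : ℕ} (hn : 1 ≤ n)
    (P : Matrix (Fin J) (Fin L) (MvPolynomial (Fin n) ℂ))
    (hP : ∀ j l, (P j l).IsHomogeneous m)
    (N : Fin μ → Submodule (MvPolynomial (Fin n) ℂ) (Fin L → MvPolynomial (Fin n) ℂ))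
    (hN : HomogSol.IsPrimaryDecomposition (HomogSol.transposeModule P) N)
    {ρ : Fin μ → ℕ} (B : (σ : Fin μ) → Fin (ρ σ) → HomogSol.PolyDiffOp n L)
    (hB : ∀ σ, HomogSol.IsNoetherianFamily (N σ) (B σ))
    (lam : ℂ) (Ω : Set (Fin n → ℝ)) (hΩ : HomogSol.IsOPC Ω) :
    HomogSol.homogFamily N B lam Ω ⊆
      HomogSol.solutionSpace P Ω ∩ HomogSol.homogSpaceVec L lam Ω :=
  proposition3p4_general P hP N (fun σ => hN.iInf_eq.trans_le (iInf_le N σ)) B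
    (fun σ f => (hB σ f).1) lam hΩ.isOpen (hΩ.zero_notMem hn)
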